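/- Let $k$ be a field of characteristic $p>0$ and let $G$ be a finite $p$-group of order $p^n$, so $n=\log_p|G|$. A $k$-$G$-algebra is a commutative $k$-algebra $A$ on which $G$ acts by $k$-algebra automorphisms; $A^G$ denotes its ring of invariants, and $\operatorname{tr}:A\to A^G$, $a\mapsto\sum_{g\in G}g(a)$, its trace map. Write $k^{[m]}$ for the polynomial ring in $m$ variables over $k$. Let $\mathfrak{Ts}$ be the category of finitely generated $k$-$G$-algebras $A$ that are trace-surjective, i.e. $\operatorname{tr}(A)=A^G$, with $G$-equivariant $k$-algebra homomorphisms as morphisms. An object $P\in\mathfrak{Ts}$ is called s-projective if for every surjective morphism $\alpha:A\to B$ and every morphism $\beta:P\to B$ in $\mathfrak{Ts}$ there is a morphism $\theta:P\to A$ in $\mathfrak{Ts}$ with $\alpha\circ\theta=\beta$. Let $S$ be a $k$-$G$-algebra that is a polynomial ring $k[T_1,\dots,T_d]\cong k^{[d]}$ with triangular $G$-action, i.e. $g(T_i)-T_i\in k[T_1,\dots,T_{i-1}]$ for all $g\in G$ and $1\le i\le d$. (For example, $S=\mathrm{Sym}(V^*)$ with the induced action is of this form, with $d=\dim_k V$,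 for every finite-dimensional $k$-linear representation $V$ of $G$.) Then: 1. There are an s-projective $k$-$G$-algebra $P\in\mathfrak{Ts}$ with $P\cong k^{[d+n]}$ as a $k$-algebra, an injective $G$-equivariant $k$-algebra homomorphism $S\hookrightarrow P$, and two $k$-subalgebras $B,C\subseteq P$, each isomorphic to a polynomial ring in finitely many variables over $k$, such that the image of $S^G$ in $P$ equals $B\cap C$. 2. If moreover $S\in\mathfrak{Ts}$, then $S^G\otimes_k k^{[n]}\cong k^{[n+d]}$ as $k$-algebras, i.e. $S^G$ is $n$-stably polynomial. -/

import Mathlib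

open scoped TensorProduct

universe u v w x

/-! A `k`-`G`-algebra is a commutative `k`-algebra `A` on which `G` acts by `k`-algebra
automorphisms, i.e. `[CommRing A] [Algebra k A] [MulSemiringAction G A] [SMulCommClass G k A]`.
Its ring of invariants is Mathlib's `FixedPoints.subalgebra k A G`. -/

namespace ModularInvariants

/-- `A` is isomorphic to the polynomial ring `k^{[m]}` in `m` variables over `k`. -/
def IsPolynomialRing (k : Type u) [Field k] (A : Type v) [CommRing A] [Algebra k A] (m : ℕ) :
    Prop :=
  Nonempty (A ≃ₐ[k] MvPolynomial (Fin m) k)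

section Action

variable (k : Type u) [Field k] (G : Type w) [Group G]

/-- `A` is a polynomial ring `k[T_1, …, T_d]` on which `G` acts triangularly with respect to the
generators `T_i`: for all `g` and `i`, `g T_i - T_i ∈ k[T_1, …, T_{i-1}]`. -/
def IsTriangularPolynomial (A : Type v) [CommRing A] [Algebra k A] [MulSemiringAction G A]
    (d : ℕ) : Prop :=
  ∃ e : MvPolynomial (Fin d) k ≃ₐ[k] A, ∀ (g : G) (i : Fin d),
    g • e (MvPolynomial.X i) - e (MvPolynomial.X i) ∈
      Algebra.adjoin k ((fun j : Fin d => e (MvPolynomial.X j)) '' {j | j < i})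

/-- The trace (transfer) map `a ↦ ∑ g, g a`. -/
def trace [Fintype G] {A : Type v} [CommRing A] [MulSemiringAction G A] (a : A) : A :=
  ∑ g : G, g • a

/-- `A` is trace-surjective: `tr(A) = A^G`. -/
def IsTraceSurjective [Fintype G] (A : Type v) [CommRing A] [MulSemiringAction G A] : Prop :=
  Set.range (trace G : A → A) = MulAction.fixedPoints G A

/-- `A` is an object of the category of finitely generated trace-surjective `k`-`G`-algebras. -/
def IsTsAlgebra [Fintype G] (A : Type v) [CommRing A] [Algebra k A] [MulSemiringAction G A] :
    Prop :=
  Algebra.FiniteType k A ∧ IsTraceSurjective G A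

variable {k}

/-- A `k`-algebra homomorphism is `G`-equivariant. -/
def IsEquivariant {A : Type*} {B : Type*} [CommRing A] [Algebra k A] [MulSemiringAction G A]
    [CommRing B] [Algebra k B] [MulSemiringAction G B] (φ : A →ₐ[k] B) : Prop :=
  ∀ (g : G) (a : A), φ (g • a) = g • φ a

variable (k)

/-- `P` is s-projective: it is a finitely generated trace-surjective `k`-`G`-algebra, and every
morphism `β : P → B` of such algebras lifts along every surjective morphism `α : A → B` of such
algebras. It suffices to let `A` and `B` range over the universe of `k`, since every finitely
generated `k`-algebra is isomorphic to a quotient of some `MvPolynomial (Fin m) k`. -/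
def IsSProjective [Fintype G] (P : Type v) [CommRing P] [Algebra k P] [MulSemiringAction G P] :
    Prop :=
  IsTsAlgebra k G P ∧
    ∀ (A B : Type u) [CommRing A] [Algebra k A] [MulSemiringAction G A] [SMulCommClass G k A]
      [CommRing B] [Algebra k B] [MulSemiringAction G B] [SMulCommClass G k B],
      IsTsAlgebra k G A → IsTsAlgebra k G B →
      ∀ (α : A →ₐ[k] B) (β : P →ₐ[k] B), IsEquivariant G α → IsEquivariant G β →
        Function.Surjective α → ∃ θ : P →ₐ[k] A, IsEquivariant G θ ∧ α.comp θ = β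

end Action

section Sym

variable {k : Type u} [Field k] {G : Type w} [Group G] {V : Type v} [AddCommGroup V] [Module k V]

/-- The symmetric algebra `S(V^*)` of the dual of a representation `ρ` of `G` on `V`. -/
def SymDual (_ρ : Representation k G V) : Type (max u v) :=
  SymmetricAlgebra k (Module.Dual k V)

noncomputable instance (ρ : Representation k G V) : CommRing (SymDual ρ) :=
  inferInstanceAs (CommRing (SymmetricAlgebra k (Module.Dual k V)))

noncomputable instance (ρ : Representation k G V) : Algebra k (SymDual ρ) :=
  inferInstanceAs (Algebra k (SymmetricAlgebra k (Module.Dual k V)))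

/-- The inclusion of `V^*` into `S(V^*)`. -/
noncomputable def SymDual.ι (ρ : Representation k G V) : Module.Dual k V →ₗ[k] SymDual ρ :=
  SymmetricAlgebra.ι k (Module.Dual k V)

theorem SymDual.algHom_ext {ρ : Representation k G V} {A : Type*} [CommRing A] [Algebra k A]
    {φ ψ : SymDual ρ →ₐ[k] A} (h : ∀ f, φ (SymDual.ι ρ f) = ψ (SymDual.ι ρ f)) : φ = ψ :=
  SymmetricAlgebra.algHom_ext (LinearMap.ext h)

/-- The algebra endomorphism of `S(V^*)` extending the action of `g` on `V^*`. -/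
noncomputable def SymDual.act (ρ : Representation k G V) (g : G) : SymDual ρ →ₐ[k] SymDual ρ :=
  SymmetricAlgebra.lift (SymDual.ι ρ ∘ₗ ρ.dual g)

theorem SymDual.act_ι (ρ : Representation k G V) (g : G) (f : Module.Dual k V) :
    SymDual.act ρ g (SymDual.ι ρ f) = SymDual.ι ρ (ρ.dual g f) :=
  SymmetricAlgebra.lift_ι_apply (SymDual.ι ρ ∘ₗ ρ.dual g) f

theorem SymDual.act_one (ρ : Representation k G V) : SymDual.act ρ 1 = AlgHom.id k _ :=
  SymDual.algHom_ext fun f => by rw [SymDual.act_ι, map_one]; rfl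

theorem SymDual.act_mul (ρ : Representation k G V) (g h : G) :
    SymDual.act ρ (g * h) = (SymDual.act ρ g).comp (SymDual.act ρ h) :=
  SymDual.algHom_ext fun f => by
    rw [AlgHom.comp_apply, SymDual.act_ι, SymDual.act_ι, SymDual.act_ι, map_mul]; rfl

/-- The action of `G` on `S(V^*)` induced by the dual (contragredient) representation on `V^*`. -/
noncomputable instance (ρ : Representation k G V) : MulSemiringAction G (SymDual ρ) where
  smul g x := SymDual.act ρ g x
  one_smul x := DFunLike.congr_fun (SymDual.act_one ρ) x
  mul_smul g h x := DFunLike.congr_fun (SymDual.act_mul ρ g h) x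
  smul_zero g := map_zero (SymDual.act ρ g)
  smul_add g := map_add (SymDual.act ρ g)
  smul_one g := map_one (SymDual.act ρ g)
  smul_mul g := map_mul (SymDual.act ρ g)

instance (ρ : Representation k G V) : SMulCommClass G k (SymDual ρ) where
  smul_comm g c x := map_smul (SymDual.act ρ g) c x

end Sym

end ModularInvariants

/-! Everything rests on one auxiliary algebra `U`: a polynomial ring in n variables with triangular
action, an element of trace 1, and invariants that are again polynomial in n variables
(`exists_triangular_trace_eq_one`). Put P = U ⊗ S with the diagonal action.

Two facts use an element of trace 1. First, a homomorphism from a triangular polynomial algebra to a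
trace-surjective target can be made equivariant one generator at a time by weighted averaging
(`IsTriangularPolynomial.exists_lift`). Lifting on both factors shows that P is s-projective.
Second, if tr x = 1 in a Noetherian A, then A ⊗ S is a polynomial ring over A in the invariant
elements tr(x ⊗ T_i), so its invariants are A^G[t_1, …, t_d]
(`IsTriangularPolynomial.nonempty_fixedPoints_diagonal`).

With A = U, the ring C = P^G is polynomial over U^G, hence over k. With B = 1 ⊗ S, the intersection
B ∩ C is the image of S^G. If S itself is trace-surjective, the roles of U and S can be exchanged,
and the same ring P^G is also S^G[n variables], which gives stable polynomiality.

The algebra `U` is built by induction on n. For a central z of order p and the algebra U of G/⟨z⟩,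
the group G acts on U[T] by T ↦ T + c(g), where c is a U-valued cocycle with c(z) = 1. The element
-uT^(p-1) has trace 1, and the invariants are U^G[Y] for a monic Y of degree p. -/

namespace ModularInvariants

/-! ### Algebras with a prescribed action. -/

section WithAction

variable {k : Type*} [Field k] {G : Type*} [Group G] {A : Type*} [CommRing A] [Algebra k A]

/-- The algebra `A` with `G` acting through the homomorphism `ρ`. -/
def WithAction (_ρ : G →* (A →ₐ[k] A)) : Type _ := A

variable (ρ : G →* (A →ₐ[k] A))

instance : CommRing (WithAction ρ) := inferInstanceAs (CommRing A)

instance : Algebra k (WithAction ρ) := inferInstanceAs (Algebra k A)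

/-- The identity `A ≃ₐ[k] WithAction ρ`. -/
def WithAction.equiv : A ≃ₐ[k] WithAction ρ := (AlgEquiv.refl : A ≃ₐ[k] A)

instance : MulSemiringAction G (WithAction ρ) where
  smul g a := WithAction.equiv ρ (ρ g ((WithAction.equiv ρ).symm a))
  one_smul a := congrArg (fun f : A →ₐ[k] A => f a) (map_one ρ)
  mul_smul g h a := congrArg (fun f : A →ₐ[k] A => f a) (map_mul ρ g h)
  smul_zero g := map_zero (ρ g)
  smul_add g := map_add (ρ g)
  smul_one g := map_one (ρ g)
  smul_mul g := map_mul (ρ g)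

instance : SMulCommClass G k (WithAction ρ) where
  smul_comm g c a := map_smul (ρ g) c a

theorem WithAction.smul_equiv (g : G) (a : A) :
    g • WithAction.equiv ρ a = WithAction.equiv ρ (ρ g a) := rfl

end WithAction

/-! ### Trace-surjectivity as the existence of an element of trace 1. -/

section Trace

variable {k : Type*} [Field k] {G : Type*} [Group G] [Fintype G]
  {A : Type*} [CommRing A] [MulSemiringAction G A]

theorem smul_trace (g : G) (a : A) : g • trace G a = trace G a := by
  simp only [trace, Finset.smul_sum, smul_smul]
  exact Fintype.sum_equiv (Equiv.mulLeft g) _ _ fun _ => rfl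

/-- The trace is linear over the invariants, so tr(xa) = tr(x)a = a for invariant a. -/
theorem isTraceSurjective_of_trace_eq_one {x : A} (hx : trace G x = 1) :
    IsTraceSurjective G A := by
  ext a
  constructor
  · rintro ⟨b, rfl⟩ g
    exact smul_trace g b
  · intro ha
    refine ⟨x * a, ?_⟩
    have : ∀ g : G, g • (x * a) = g • x * a := fun g => by rw [smul_mul', ha g]
    simp only [trace, this]
    rw [← Finset.sum_mul]
    change trace G x * a = a
    rw [hx, one_mul]

theorem IsTraceSurjective.exists_trace_eq_one (h : IsTraceSurjective G A) :
    ∃ x : A, trace G x = 1 := by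
  have : (1 : A) ∈ MulAction.fixedPoints G A := fun g => smul_one g
  rwa [← h] at this

theorem trace_map {B : Type*} [CommRing B] [MulSemiringAction G B] [Algebra k A] [Algebra k B]
    {φ : A →ₐ[k] B} (hφ : IsEquivariant G φ) (a : A) : trace G (φ a) = φ (trace G a) := by
  simp only [trace, map_sum, hφ _ _]

end Trace

/-! ### Equivariant lifting from triangular polynomial algebras. -/

section Lifting

variable {k : Type*} [Field k] {G : Type*} [Group G] [Fintype G]
  {P : Type*} [CommRing P] [Algebra k P] [MulSemiringAction G P] [SMulCommClass G k P]
  {A : Type*} [CommRing A] [Algebra k A] [MulSemiringAction G A] [SMulCommClass G k A]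
  {B : Type*} [CommRing B] [Algebra k B] [MulSemiringAction G B]

/-- The `G`-equivariant average of a homomorphism, weighted by `y`. -/
noncomputable def average (y : A) (θ : P →ₐ[k] A) : P →ₗ[k] A :=
  ∑ h : G, LinearMap.mulLeft k (h • y) ∘ₗ (MulSemiringAction.toAlgHom k A h).toLinearMap ∘ₗ
    θ.toLinearMap ∘ₗ (MulSemiringAction.toAlgHom k P h⁻¹).toLinearMap

theorem average_apply (y : A) (θ : P →ₐ[k] A) (f : P) :
    average (G := G) y θ f = ∑ h : G, (h • y) * h • θ (h⁻¹ • f) := by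
  simp [average, LinearMap.sum_apply]

theorem average_smul (y : A) (θ : P →ₐ[k] A) (g : G) (f : P) :
    average (G := G) y θ (g • f) = g • average (G := G) y θ f := by
  simp only [average_apply, Finset.smul_sum]
  symm
  refine Fintype.sum_equiv (Equiv.mulLeft g) _ _ fun h => ?_
  simp [smul_mul', smul_smul]

theorem average_of_equivariant {y : A} (hy : trace G y = 1) (θ : P →ₐ[k] A) (f : P)
    (hf : ∀ g : G, θ (g • f) = g • θ f) : average (G := G) y θ f = θ f := by
  simp only [average_apply, hf, smul_inv_smul]
  rw [← Finset.sum_mul]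
  change trace G y * _ = _
  rw [hy, one_mul]

/-- The subalgebra of elements whose orbit maps equivariantly. -/
def equivariantLocus (θ : P →ₐ[k] A) : Subalgebra k P where
  carrier := {f | ∀ g : G, θ (g • f) = g • θ f}
  mul_mem' {a b} ha hb g := by simp only [smul_mul', map_mul, ha g, hb g]
  add_mem' {a b} ha hb g := by simp only [smul_add, map_add, ha g, hb g]
  algebraMap_mem' r g := by simp [smul_algebraMap]

/-- Start from any lift of β and replace its values on the generators by their averages, repeatedly.
Averaging keeps the composite with α equal to β, since tr(y) = 1, and does not disturb generators
already treated equivariantly. Triangularity makes each round gain one more generator. -/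
theorem IsTriangularPolynomial.exists_lift {d : ℕ} (hP : IsTriangularPolynomial k G P d)
    {y : A} (hy : trace G y = 1) {α : A →ₐ[k] B} {β : P →ₐ[k] B} (hα : IsEquivariant G α)
    (hβ : IsEquivariant G β) (hsurj : Function.Surjective α) :
    ∃ θ : P →ₐ[k] A, IsEquivariant G θ ∧ α.comp θ = β := by
  obtain ⟨e, he⟩ := hP
  have hgen : ∀ {C : Type _} [CommRing C] [Algebra k C] (s : Fin d → C) (i : Fin d),
      ((MvPolynomial.aeval s).comp (e.symm : P →ₐ[k] MvPolynomial (Fin d) k))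
        (e (MvPolynomial.X i)) = s i := by
    intro C _ _ s i
    simp
  have hext : ∀ {C : Type _} [CommRing C] [Algebra k C] (φ ψ : P →ₐ[k] C),
      (∀ i, φ (e (MvPolynomial.X i)) = ψ (e (MvPolynomial.X i))) → φ = ψ := by
    intro C _ _ φ ψ h
    have : φ.comp (e : MvPolynomial (Fin d) k →ₐ[k] P) =
        ψ.comp (e : MvPolynomial (Fin d) k →ₐ[k] P) := MvPolynomial.algHom_ext fun i => h i
    ext x
    simpa using DFunLike.congr_fun this (e.symm x)
  have key : ∀ m : ℕ, ∃ θ : P →ₐ[k] A, α.comp θ = β ∧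
      ∀ i : Fin d, (i : ℕ) < m → e (MvPolynomial.X i) ∈ equivariantLocus (G := G) θ := by
    intro m
    induction m with
    | zero =>
      choose s hs using fun i : Fin d => hsurj (β (e (MvPolynomial.X i)))
      refine ⟨(MvPolynomial.aeval s).comp e.symm, hext _ _ fun i => ?_, fun i hi => by omega⟩
      rw [AlgHom.comp_apply, hgen, hs]
    | succ m ih =>
      obtain ⟨θ, hθ, hm⟩ := ih
      -- The average is only k-linear, so the new homomorphism is prescribed by it on generators
      -- only.
      let s : Fin d → A := fun i => average (G := G) y θ (e (MvPolynomial.X i))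
      let θ' : P →ₐ[k] A := (MvPolynomial.aeval s).comp e.symm
      have hθ' : ∀ i, θ' (e (MvPolynomial.X i)) =
        average (G := G) y θ (e (MvPolynomial.X i)) := hgen s
      have hle : ∀ i : Fin d, (i : ℕ) ≤ m →
          Algebra.adjoin k ((fun j : Fin d => e (MvPolynomial.X j)) '' {j | j < i}) ≤
            equivariantLocus (G := G) θ ⊓ AlgHom.equalizer θ' θ := by
        intro i hi
        rw [Algebra.adjoin_le_iff]
        rintro _ ⟨j, hj, rfl⟩
        have hj' : (j : ℕ) < m := lt_of_lt_of_le hj hi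
        refine ⟨hm j hj', ?_⟩
        exact (hθ' j).trans (average_of_equivariant hy θ _ (hm j hj'))
      refine ⟨θ', hext _ _ fun i => ?_, fun i hi g => ?_⟩
      · have hαθ : ∀ f, α (θ f) = β f := fun f => DFunLike.congr_fun hθ f
        rw [AlgHom.comp_apply, hθ', average_apply, map_sum]
        simp only [map_mul, hα _ _, hαθ, hβ _ _, smul_inv_smul]
        rw [← Finset.sum_mul]
        simp only [← hα _ _]
        rw [← map_sum]
        change α (trace G y) * _ = _
        rw [hy, map_one, one_mul]
      -- On gT_i - T_i the maps θ, θ' and the average all agree. As θ' and the average also agree at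
      -- T_i, they agree at gT_i, and the average is equivariant.
      · obtain ⟨h1, h2⟩ := hle i (by omega) (he g i)
        have h2 : θ' (g • e (MvPolynomial.X i) - e (MvPolynomial.X i)) =
          θ (g • e (MvPolynomial.X i) - e (MvPolynomial.X i)) := h2
        have h3 := average_of_equivariant hy θ _ h1
        rw [← h2, map_sub, map_sub, hθ', sub_left_inj] at h3
        rw [← h3, hθ', average_smul]
  obtain ⟨θ, hθ, hd⟩ := key d
  refine ⟨θ, fun g f => ?_, hθ⟩
  have : (e : MvPolynomial (Fin d) k →ₐ[k] P).range ≤ equivariantLocus (G := G) θ := by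
    rw [← Algebra.map_top, ← MvPolynomial.adjoin_range_X, AlgHom.map_adjoin, Algebra.adjoin_le_iff]
    rintro _ ⟨_, ⟨i, rfl⟩, rfl⟩
    exact hd i i.2
  exact this ⟨e.symm f, by simp⟩ g

end Lifting

end ModularInvariants

namespace ModularInvariants

/-! ### Invariants under equivariant isomorphism. -/

section Transport

variable {k : Type*} [Field k] {G : Type*} [Group G]
  {A : Type*} [CommRing A] [Algebra k A] [MulSemiringAction G A] [SMulCommClass G k A]
  {B : Type*} [CommRing B] [Algebra k B] [MulSemiringAction G B] [SMulCommClass G k B]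

theorem IsEquivariant.map_fixedPoints (e : A ≃ₐ[k] B) (he : IsEquivariant G (e : A →ₐ[k] B)) :
    (FixedPoints.subalgebra k A G).map (e : A →ₐ[k] B) = FixedPoints.subalgebra k B G := by
  ext b
  constructor
  · rintro ⟨a, ha, rfl⟩ g
    exact (he g a).symm.trans (congrArg e (ha g))
  · intro hb
    refine ⟨e.symm b, fun g => e.injective ?_, by simp⟩
    exact (he g _).trans (by simpa using hb g)

/-- Equivariantly isomorphic algebras have isomorphic invariants. -/
noncomputable def fixedPointsEquiv (e : A ≃ₐ[k] B) (he : IsEquivariant G (e : A →ₐ[k] B)) :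
    FixedPoints.subalgebra k A G ≃ₐ[k] FixedPoints.subalgebra k B G :=
  (Subalgebra.equivMapOfInjective _ (e : A →ₐ[k] B) e.injective).trans
    (Subalgebra.equivOfEq _ _ (IsEquivariant.map_fixedPoints e he))

end Transport

/-! ### Tensor products with diagonal action. -/

section Diagonal

variable (k : Type*) [Field k] (G : Type*) [Group G]
  (A : Type*) [CommRing A] [Algebra k A] [MulSemiringAction G A] [SMulCommClass G k A]
  (B : Type*) [CommRing B] [Algebra k B] [MulSemiringAction G B] [SMulCommClass G k B]

/-- The diagonal action on a tensor product. -/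
noncomputable def diagonalHom : G →* (A ⊗[k] B →ₐ[k] A ⊗[k] B) where
  toFun g := Algebra.TensorProduct.map (MulSemiringAction.toAlgHom k A g)
    (MulSemiringAction.toAlgHom k B g)
  map_one' := Algebra.TensorProduct.ext' fun a b => by simp
  map_mul' g h := Algebra.TensorProduct.ext' fun a b => by simp [mul_smul]

/-- The tensor product with its diagonal action. -/
abbrev Diagonal : Type _ := WithAction (diagonalHom k G A B)

variable {k G A B}

/-- The pure tensor `a ⊗ b` in the tensor product with diagonal action. -/
noncomputable def Diagonal.tmul (a : A) (b : B) : Diagonal k G A B :=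
  WithAction.equiv (diagonalHom k G A B) (a ⊗ₜ[k] b)

theorem Diagonal.smul_tmul (g : G) (a : A) (b : B) :
    g • (Diagonal.tmul a b : Diagonal k G A B) = Diagonal.tmul (g • a) (g • b) := rfl

variable (k G A B)

/-- The left inclusion into the tensor product. -/
noncomputable def Diagonal.inl : A →ₐ[k] Diagonal k G A B :=
  (WithAction.equiv (diagonalHom k G A B) : A ⊗[k] B →ₐ[k] _).comp
    Algebra.TensorProduct.includeLeft

/-- The right inclusion into the tensor product. -/
noncomputable def Diagonal.inr : B →ₐ[k] Diagonal k G A B :=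
  (WithAction.equiv (diagonalHom k G A B) : A ⊗[k] B →ₐ[k] _).comp
    Algebra.TensorProduct.includeRight

variable {k G A B}

theorem Diagonal.isEquivariant_inl : IsEquivariant G (Diagonal.inl k G A B) := fun g a => by
  change Diagonal.tmul (g • a) (1 : B) = g • (Diagonal.tmul a 1 : Diagonal k G A B)
  rw [Diagonal.smul_tmul, smul_one]

theorem Diagonal.isEquivariant_inr : IsEquivariant G (Diagonal.inr k G A B) := fun g b => by
  change Diagonal.tmul (1 : A) (g • b) = g • (Diagonal.tmul 1 b : Diagonal k G A B)
  rw [Diagonal.smul_tmul, smul_one]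

theorem Diagonal.tmul_eq (a : A) (b : B) :
    (Diagonal.tmul a b : Diagonal k G A B) = Diagonal.inl k G A B a * Diagonal.inr k G A B b := by
  simp [Diagonal.tmul, Diagonal.inl, Diagonal.inr, ← map_mul]

theorem Diagonal.inr_injective [Nontrivial A] : Function.Injective (Diagonal.inr k G A B) :=
  (WithAction.equiv (diagonalHom k G A B)).injective.comp
    (Algebra.TensorProduct.includeRight_injective (algebraMap k A).injective)

variable (k G A B)

/-- The flip of the factors, as an isomorphism of tensor products with diagonal action. -/
noncomputable def Diagonal.comm : Diagonal k G A B ≃ₐ[k] Diagonal k G B A :=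
  (WithAction.equiv (diagonalHom k G A B)).symm.trans
    ((Algebra.TensorProduct.comm k A B).trans (WithAction.equiv (diagonalHom k G B A)))

variable {k G A B}

theorem Diagonal.isEquivariant_comm :
    IsEquivariant G (Diagonal.comm k G A B : Diagonal k G A B →ₐ[k] Diagonal k G B A) := by
  intro g x
  change Algebra.TensorProduct.comm k A B (Algebra.TensorProduct.map
    (MulSemiringAction.toAlgHom k A g) (MulSemiringAction.toAlgHom k B g) x) =
    Algebra.TensorProduct.map (MulSemiringAction.toAlgHom k B g)
      (MulSemiringAction.toAlgHom k A g) (Algebra.TensorProduct.comm k A B x)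
  induction x using TensorProduct.induction_on with
  | zero => simp
  | tmul a b => simp
  | add x y hx hy => simp only [map_add, hx, hy]

theorem Diagonal.exists_lift {C D : Type*} [CommRing C] [Algebra k C] [MulSemiringAction G C]
    [CommRing D] [Algebra k D] [MulSemiringAction G D]
    {α : C →ₐ[k] D} (β : Diagonal k G A B →ₐ[k] D)
    (hA : ∃ θ : A →ₐ[k] C, IsEquivariant G θ ∧ α.comp θ = β.comp (Diagonal.inl k G A B))
    (hB : ∃ θ : B →ₐ[k] C, IsEquivariant G θ ∧ α.comp θ = β.comp (Diagonal.inr k G A B)) :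
    ∃ θ : Diagonal k G A B →ₐ[k] C, IsEquivariant G θ ∧ α.comp θ = β := by
  obtain ⟨θA, hA, hA'⟩ := hA
  obtain ⟨θB, hB, hB'⟩ := hB
  let θ : Diagonal k G A B →ₐ[k] C := (Algebra.TensorProduct.productMap θA θB).comp
    ((WithAction.equiv (diagonalHom k G A B)).symm : _ →ₐ[k] A ⊗[k] B)
  have hθ : ∀ a b, θ (Diagonal.tmul a b) = θA a * θB b := fun a b => by
    simp [θ, Diagonal.tmul]
  refine ⟨θ, fun g x => ?_, ?_⟩
  · obtain ⟨x, rfl⟩ := (WithAction.equiv (diagonalHom k G A B)).surjective x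
    induction x using TensorProduct.induction_on with
    | zero => simp
    | tmul a b =>
      change θ (g • Diagonal.tmul a b) = g • θ (Diagonal.tmul a b)
      rw [Diagonal.smul_tmul, hθ, hθ, hA, hB, smul_mul']
    | add x y hx hy => simp only [map_add, smul_add, hx, hy]
  · ext x
    obtain ⟨x, rfl⟩ := (WithAction.equiv (diagonalHom k G A B)).surjective x
    induction x using TensorProduct.induction_on with
    | zero => simp
    | tmul a b =>
      change α (θ (Diagonal.tmul a b)) = β (Diagonal.tmul a b)
      rw [hθ, map_mul, Diagonal.tmul_eq, map_mul]
      congr 1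
      · exact DFunLike.congr_fun hA' a
      · exact DFunLike.congr_fun hB' b
    | add x y hx hy => simp only [map_add, hx, hy]

end Diagonal

/-! ### Invariants of A ⊗ S for trace-surjective A. -/

section Invariants

/-- The kernels of the iterates stabilise, say at f^n. If f(a) = 0 and a = f^n(b), then b lies in
ker f^(n+1) = ker f^n, so a = 0. -/
theorem injective_of_surjective_ringEndomorphism {R : Type*} [CommRing R] [IsNoetherianRing R]
    (f : R →+* R) (hf : Function.Surjective f) : Function.Injective f := by
  have hmono : Monotone fun n : ℕ => RingHom.ker (f ^ n) := by
    refine monotone_nat_of_le_succ fun n a ha => ?_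
    rw [RingHom.mem_ker] at ha ⊢
    rw [pow_succ', RingHom.mul_def, RingHom.comp_apply, ha, map_zero]
  obtain ⟨n, hn⟩ := monotone_stabilizes_iff_noetherian.2 ‹IsNoetherianRing R› ⟨_, hmono⟩
  rw [injective_iff_map_eq_zero]
  intro a ha
  obtain ⟨b, rfl⟩ : ∃ b, (f ^ n) b = a := by
    rw [RingHom.coe_pow]
    exact hf.iterate n a
  have hb : b ∈ RingHom.ker (f ^ (n + 1)) := by
    rwa [RingHom.mem_ker, pow_succ', RingHom.mul_def, RingHom.comp_apply]
  have h := hn (n + 1) (Nat.le_succ n)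
  simp only [OrderHom.coe_mk] at h
  rwa [← h] at hb

variable {k : Type*} [Field k] {G : Type*} [Group G] [Fintype G]
  {A : Type*} [CommRing A] [Algebra k A] [MulSemiringAction G A] [SMulCommClass G k A]
  {S : Type*} [CommRing S] [Algebra k S] [MulSemiringAction G S] [SMulCommClass G k S]

/-- Over a trace-surjective algebra, a triangular action becomes trivial after a change of
variables. -/
theorem IsTriangularPolynomial.exists_invariant_generators {d : ℕ}
    (hS : IsTriangularPolynomial k G S d) [IsNoetherianRing A] {x : A} (hx : trace G x = 1) :
    ∃ t : Fin d → Diagonal k G A S, (∀ (g : G) (i : Fin d), g • t i = t i) ∧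
      Function.Bijective
        (MvPolynomial.eval₂ (Diagonal.inl k G A S : A →+* Diagonal k G A S) t) := by
  obtain ⟨e, he⟩ := hS
  -- By triangularity, tr(x ⊗ T_i) is 1 ⊗ T_i plus a polynomial over A in the earlier variables.
  let t : Fin d → Diagonal k G A S := fun i => trace G (Diagonal.tmul x (e (MvPolynomial.X i)))
  let E : MvPolynomial (Fin d) A ≃+* Diagonal k G A S :=
    ((MvPolynomial.algebraTensorAlgEquiv k A).symm.toRingEquiv.trans
      (Algebra.TensorProduct.congr (AlgEquiv.refl : A ≃ₐ[k] A) e).toRingEquiv).trans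
        (WithAction.equiv (diagonalHom k G A S)).toRingEquiv
  have hEX : ∀ i, E (MvPolynomial.X i) = Diagonal.inr k G A S (e (MvPolynomial.X i)) := by
    intro i
    simp [E, Diagonal.inr]
  have hEC : ∀ a, E (MvPolynomial.C a) = Diagonal.inl k G A S a := by
    intro a
    simp [E, Diagonal.inl, ← MvPolynomial.monomial_zero']
    rw [MvPolynomial.monomial_zero', map_one, map_one]
  let Φ : MvPolynomial (Fin d) A →+* Diagonal k G A S :=
    MvPolynomial.eval₂Hom (Diagonal.inl k G A S : A →+* Diagonal k G A S) t
  have hC : ∀ a, Diagonal.inl k G A S a ∈ Φ.range := fun a =>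
    ⟨MvPolynomial.C a, MvPolynomial.eval₂_C _ _ _⟩
  let R : Subalgebra k S :=
    { Φ.range.comap (Diagonal.inr k G A S : S →+* Diagonal k G A S) with
      algebraMap_mem' := fun c => by
        change Diagonal.inr k G A S (algebraMap k S c) ∈ Φ.range
        rw [AlgHom.commutes, ← AlgHom.commutes (Diagonal.inl k G A S)]
        exact hC _ }
  have hR : ∀ m : ℕ, ∀ i : Fin d, (i : ℕ) < m → e (MvPolynomial.X i) ∈ R := by
    intro m
    induction m with
    | zero => intro i hi; omega
    | succ m ih =>
      intro i hi
      have hle : Algebra.adjoin k ((fun j : Fin d => e (MvPolynomial.X j)) '' {j | j < i}) ≤ R := by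
        rw [Algebra.adjoin_le_iff]
        rintro _ ⟨j, hj, rfl⟩
        have hj : (j : ℕ) < i := hj
        exact ih j (by omega)
      change Diagonal.inr k G A S (e (MvPolynomial.X i)) ∈ Φ.range
      have ht : t i = Diagonal.inr k G A S (e (MvPolynomial.X i)) +
          ∑ g : G, Diagonal.inl k G A S (g • x) *
            Diagonal.inr k G A S (g • e (MvPolynomial.X i) - e (MvPolynomial.X i)) := by
        simp only [map_sub, mul_sub, Finset.sum_sub_distrib]
        rw [← Finset.sum_mul, ← map_sum]
        change _ = _ + (_ - Diagonal.inl k G A S (trace G x) * _)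
        rw [hx, map_one, one_mul, add_sub_cancel]
        refine Finset.sum_congr rfl fun g _ => ?_
        rw [Diagonal.smul_tmul, Diagonal.tmul_eq]
      rw [eq_sub_of_add_eq ht.symm]
      refine sub_mem ⟨MvPolynomial.X i, MvPolynomial.eval₂_X _ _ _⟩ (sum_mem fun g _ => ?_)
      exact mul_mem (hC _) (hle (he g i))
  have hsurj : Function.Surjective Φ := by
    rw [← RingHom.range_eq_top]
    have : ∀ q : MvPolynomial (Fin d) A, E q ∈ Φ.range := by
      intro q
      induction q using MvPolynomial.induction_on with
      | C a => rw [hEC]; exact hC a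
      | add p q hp hq => rw [map_add]; exact add_mem hp hq
      | mul_X p i hp => rw [map_mul, hEX]; exact mul_mem hp (hR _ i i.2)
    exact top_le_iff.1 fun y _ => by simpa using this (E.symm y)
  refine ⟨t, fun g i => smul_trace g _, ?_, hsurj⟩
  -- Algebraic independence of the t_i comes for free: a surjective endomorphism of the Noetherian
  -- ring A[X_1, …, X_d] is injective.
  have hinj : Function.Injective (E.symm.toRingHom.comp Φ) :=
    injective_of_surjective_ringEndomorphism _ (E.symm.surjective.comp hsurj)
  exact fun a b hab => hinj (congrArg E.symm hab)

/-- In the invariant coordinates t_i the group acts on coefficients alone, so an element is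
invariant exactly when all its coefficients are. -/
theorem IsTriangularPolynomial.nonempty_fixedPoints_diagonal {d : ℕ}
    (hS : IsTriangularPolynomial k G S d) [IsNoetherianRing A] {x : A} (hx : trace G x = 1) :
    Nonempty (MvPolynomial (Fin d) (FixedPoints.subalgebra k A G) ≃ₐ[k]
      FixedPoints.subalgebra k (Diagonal k G A S) G) := by
  obtain ⟨t, ht, hbij⟩ := hS.exists_invariant_generators hx
  let Φ : MvPolynomial (Fin d) A →+* Diagonal k G A S :=
    MvPolynomial.eval₂Hom (Diagonal.inl k G A S : A →+* Diagonal k G A S) t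
  have hΦ : ∀ (g : G) (f : MvPolynomial (Fin d) A),
      Φ (MvPolynomial.map (MulSemiringAction.toRingHom G A g) f) = g • Φ f := by
    intro g f
    induction f using MvPolynomial.induction_on with
    | C a => simpa [Φ] using Diagonal.isEquivariant_inl g a
    | add p q hp hq => simp only [map_add, hp, hq, smul_add]
    | mul_X p i hp => simp only [map_mul, hp, smul_mul', MvPolynomial.map_X]; simp [Φ, ht]
  let ι : FixedPoints.subalgebra k A G →+* A := (FixedPoints.subalgebra k A G).val
  have hι : Function.Injective ι := Subtype.val_injective
  let Ψ : MvPolynomial (Fin d) (FixedPoints.subalgebra k A G) →ₐ[k] Diagonal k G A S :=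
    { Φ.comp (MvPolynomial.map ι) with
      commutes' := fun c => by
        change Φ (MvPolynomial.map ι (MvPolynomial.C (algebraMap k _ c))) = _
        simp [Φ, ι] }
  have hΨ : ∀ f, Ψ f = Φ (MvPolynomial.map ι f) := fun f => rfl
  have hmem : ∀ f, Ψ f ∈ FixedPoints.subalgebra k (Diagonal k G A S) G := by
    intro f g
    rw [hΨ, ← hΦ, MvPolynomial.map_map]
    have : (MulSemiringAction.toRingHom G A g).comp ι = ι := RingHom.ext fun a => a.2 g
    rw [this]
  refine ⟨AlgEquiv.ofBijective (Ψ.codRestrict _ hmem) ⟨?_, ?_⟩⟩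
  · refine (AlgHom.injective_codRestrict _ _ _).2 ?_
    exact hbij.1.comp (MvPolynomial.map_injective ι hι)
  · rintro ⟨m, hm⟩
    obtain ⟨f, rfl⟩ := hbij.2 m
    have hf : f ∈ Set.range (MvPolynomial.map ι) := by
      rw [MvPolynomial.mem_range_map_iff_coeffs_subset]
      intro a ha
      obtain ⟨s, hs, rfl⟩ := MvPolynomial.mem_coeffs_iff.1 ha
      refine ⟨⟨f.coeff s, fun g => ?_⟩, rfl⟩
      have := hbij.1 ((hΦ g f).trans (hm g))
      have := congrArg (MvPolynomial.coeff s) this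
      rw [MvPolynomial.coeff_map] at this
      exact this
    obtain ⟨f, rfl⟩ := hf
    exact ⟨f, rfl⟩

end Invariants

end ModularInvariants

namespace ModularInvariants

open Polynomial

/-! ### A power sum over the prime field. -/

section PowerSum

/-- Over F_p, the polynomial Σ(X + i)^(p-1) + 1 has degree below p and vanishes at all p points,
because j^(p-1) = 1 for j ≠ 0. It is therefore zero, and the identity maps to `R`. -/
theorem sum_add_pow_card_sub_one {R : Type*} [CommRing R] (p : ℕ) [Fact p.Prime] [CharP R p]
    (t : R) : ∑ i : ZMod p, (t + (ZMod.cast i : R)) ^ (p - 1) = -1 := by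
  have hp : 1 < p := (Fact.out : p.Prime).one_lt
  let Q : (ZMod p)[X] := ∑ i : ZMod p, (X + C i) ^ (p - 1) + 1
  have hQ : Q = 0 := by
    refine eq_zero_of_natDegree_lt_card_of_eval_eq_zero Q (f := (id : ZMod p → ZMod p))
      Function.injective_id (fun a => ?_) ?_
    · have h1 : ∀ j : ZMod p, j ^ (p - 1) = 1 - if j = 0 then 1 else 0 := by
        intro j
        split_ifs with hj
        · rw [hj, zero_pow (by omega), sub_self]
        · rw [ZMod.pow_card_sub_one_eq_one hj, sub_zero]
      have h2 : ∑ i : ZMod p, (a + i) ^ (p - 1) = ∑ j : ZMod p, j ^ (p - 1) :=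
        Fintype.sum_equiv (Equiv.addLeft a) _ _ fun _ => rfl
      simp only [Q, eval_add, eval_finsetSum, eval_pow, eval_X, eval_C, eval_one, id_eq]
      rw [h2]
      simp [h1]
    · rw [ZMod.card]
      refine lt_of_le_of_lt (natDegree_add_le_of_degree_le (n := p - 1)
        (natDegree_sum_le_of_forall_le _ _ fun i _ => ?_) (by simp)) (by omega)
      exact natDegree_pow_le_of_le (p - 1) (natDegree_X_add_C i).le |>.trans (by simp)
  have h := congrArg (Polynomial.eval₂RingHom (ZMod.castHom dvd_rfl R) t) hQ
  simp only [Q, map_add, map_sum, map_pow, map_one, map_zero, coe_eval₂RingHom, eval₂_X,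
    eval₂_C, ZMod.castHom_apply] at h
  exact eq_neg_of_add_eq_zero_left h

end PowerSum

/-! ### Cosets of ⟨z⟩ and the cocycle c. -/

section CyclicQuotient

variable {G : Type*} [Group G] {z : G}

/-- Write g = r z^i with r the chosen representative of its coset. The exponent i is determined
modulo p, so it has a well-defined image in k. -/
theorem exists_translation_function {k : Type*} [Field k] {p : ℕ} [CharP k p]
    (hz : orderOf z = p) : ∃ φ : G → k, ∀ g, φ (g * z) = φ g + 1 := by
  have h : ∀ g : G, ∃ i : ℤ, g = (g : G ⧸ Subgroup.zpowers z).out * z ^ i := by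
    intro g
    obtain ⟨⟨_, i, rfl⟩, hi⟩ := QuotientGroup.mk_out_eq_mul (Subgroup.zpowers z) g
    refine ⟨-i, ?_⟩
    rw [hi]
    simp
  choose i hi using h
  refine ⟨fun g => (i g : k), fun g => ?_⟩
  have hmk : ((g * z : G) : G ⧸ Subgroup.zpowers z) = g :=
    QuotientGroup.mk_mul_of_mem g (Subgroup.mem_zpowers z)
  have h1 := hi (g * z)
  rw [hmk] at h1
  nth_rw 1 [hi g] at h1
  rw [mul_assoc, mul_right_inj, ← zpow_add_one, zpow_eq_zpow_iff_modEq, hz] at h1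
  have h2 := (CharP.intCast_eq_intCast k p).2 h1
  simp only [← h2, Int.cast_add, Int.cast_one]

theorem apply_out_of_mul_right_invariant {X : Type*} {F : G → X} (hF : ∀ g, F (g * z) = F g)
    (g : G) : F (g : G ⧸ Subgroup.zpowers z).out = F g := by
  obtain ⟨⟨_, i, rfl⟩, hi⟩ := QuotientGroup.mk_out_eq_mul (Subgroup.zpowers z) g
  rw [hi]
  change F (g * z ^ i) = F g
  clear hi
  induction i using Int.induction_on with
  | zero => simp
  | succ i ih => rw [zpow_add_one, ← mul_assoc, hF, ih]
  | pred i ih => rw [← hF, mul_assoc, ← zpow_add_one, sub_add_cancel, ih]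

variable [Fintype (G ⧸ Subgroup.zpowers z)]

theorem sum_eq_sum_quotient [Fintype G] {p : ℕ} [Fact p.Prime] (hz : orderOf z = p) {X : Type*}
    [AddCommMonoid X] (F : G → X) :
    ∑ g : G, F g = ∑ q : G ⧸ Subgroup.zpowers z, ∑ i : ZMod p, F (q.out * z ^ i.val) := by
  classical
  rw [← Fintype.sum_prod_type']
  symm
  refine Fintype.sum_bijective
    (fun x : (G ⧸ Subgroup.zpowers z) × ZMod p => x.1.out * z ^ x.2.val) ⟨?_, ?_⟩ _ _ fun _ => rfl
  · rintro ⟨q, i⟩ ⟨r, j⟩ h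
    simp only at h
    have hq : q = r := by
      have := congrArg (QuotientGroup.mk : G → G ⧸ Subgroup.zpowers z) h
      rw [QuotientGroup.mk_mul_of_mem _ (Subgroup.npow_mem_zpowers z _),
        QuotientGroup.mk_mul_of_mem _ (Subgroup.npow_mem_zpowers z _),
        QuotientGroup.out_eq', QuotientGroup.out_eq'] at this
      exact this
    subst hq
    rw [mul_right_inj] at h
    have := pow_injOn_Iio_orderOf (x := z) (Set.mem_Iio.2 (hz.symm ▸ ZMod.val_lt i))
      (Set.mem_Iio.2 (hz.symm ▸ ZMod.val_lt j)) h
    rw [ZMod.val_injective p this]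
  · intro g
    obtain ⟨⟨h, hh⟩, hi⟩ := QuotientGroup.mk_out_eq_mul (Subgroup.zpowers z) g
    obtain ⟨m, hm, hmz⟩ := Finset.mem_image.1
      (mem_zpowers_iff_mem_range_orderOf.1 (inv_mem hh))
    rw [Finset.mem_range, hz] at hm
    refine ⟨⟨g, (m : ZMod p)⟩, ?_⟩
    simp only [hi, ZMod.val_natCast, Nat.mod_eq_of_lt hm]
    simp [hmz]

variable [(Subgroup.zpowers z).Normal]

/-- `F` descends to the quotient, where left multiplication by g permutes the cosets. -/
theorem sum_out_mul_of_mul_right_invariant {X : Type*} [AddCommMonoid X]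
    {F : G → X} (hF : ∀ g, F (g * z) = F g) (g : G) :
    ∑ q : G ⧸ Subgroup.zpowers z, F (g * q.out) = ∑ q : G ⧸ Subgroup.zpowers z, F q.out := by
  refine Fintype.sum_equiv (Equiv.mulLeft (g : G ⧸ Subgroup.zpowers z)) _ _ fun q => ?_
  have := apply_out_of_mul_right_invariant hF (g * q.out)
  rw [QuotientGroup.mk_mul, QuotientGroup.out_eq'] at this
  exact this.symm

/-- Triviality of the transgression: the character of the central subgroup generated by `z`
extends to a cocycle with values in a trace-surjective algebra of the quotient. -/
theorem exists_cocycle {k : Type*} [Field k] {p : ℕ} [CharP k p] (hz : orderOf z = p)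
    (hcen : z ∈ Subgroup.center G) {U : Type*} [CommRing U] [Algebra k U]
    [MulSemiringAction (G ⧸ Subgroup.zpowers z) U] [SMulCommClass (G ⧸ Subgroup.zpowers z) k U]
    {u : U} (hu : trace (G ⧸ Subgroup.zpowers z) u = 1) :
    ∃ c : G → U, (∀ g h : G, c (g * h) = c g + (g : G ⧸ Subgroup.zpowers z) • c h) ∧ c z = 1 := by
  obtain ⟨φ, hφ⟩ := exists_translation_function (k := k) hz
  have hinv : ∀ a b g : G, φ (a * (g * z)) - φ (b * (g * z)) = φ (a * g) - φ (b * g) := by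
    intro a b g
    rw [← mul_assoc, ← mul_assoc, hφ, hφ, add_sub_add_right_eq_sub]
  -- Formally this is w - gw for w = Σ φ(q) q·u. The function φ is not defined on cosets, but the
  -- differences φ(a) - φ(g⁻¹a) are, so the cocycle identity survives although c need not be a
  -- coboundary.
  refine ⟨fun g => ∑ q : G ⧸ Subgroup.zpowers z, (φ q.out - φ (g⁻¹ * q.out)) • q • u, ?_, ?_⟩
  · intro g h
    have key : ∑ q : G ⧸ Subgroup.zpowers z, (φ (g⁻¹ * q.out) - φ (h⁻¹ * g⁻¹ * q.out)) • q • u =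
        (g : G ⧸ Subgroup.zpowers z) •
          ∑ q : G ⧸ Subgroup.zpowers z, (φ q.out - φ (h⁻¹ * q.out)) • q • u := by
      have := sum_out_mul_of_mul_right_invariant (z := z)
        (F := fun a => (φ (g⁻¹ * a) - φ (h⁻¹ * g⁻¹ * a)) • (a : G ⧸ Subgroup.zpowers z) • u)
        (fun a => by
          rw [hinv, QuotientGroup.mk_mul_of_mem a (Subgroup.mem_zpowers z)]) g
      simp only [QuotientGroup.out_eq', QuotientGroup.mk_mul] at this
      rw [← this, Finset.smul_sum]
      refine Finset.sum_congr rfl fun q _ => ?_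
      rw [smul_comm (g : G ⧸ Subgroup.zpowers z) (φ q.out - φ (h⁻¹ * q.out)) (q • u),
        smul_smul (g : G ⧸ Subgroup.zpowers z)]
      congr 3
      · rw [inv_mul_cancel_left]
      · group
    rw [← key, ← Finset.sum_add_distrib]
    refine Finset.sum_congr rfl fun q _ => ?_
    rw [← add_smul, sub_add_sub_cancel, mul_inv_rev]
  · have : ∀ q : G ⧸ Subgroup.zpowers z, φ q.out - φ (z⁻¹ * q.out) = 1 := by
      intro q
      have h := hφ (z⁻¹ * q.out)
      rw [Subgroup.mem_center_iff.1 hcen, mul_inv_cancel_left] at h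
      rw [h, add_sub_cancel_left]
    simp only [this, one_smul]
    exact hu

end CyclicQuotient

/-! ### The action T ↦ T + c(g) on U[T] and its invariants. -/

section AffineExtension

variable {k : Type*} [Field k] {G H : Type*} [Group G] [Group H] (π : G →* H)
  {U : Type*} [CommRing U] [Algebra k U] [MulSemiringAction H U] [SMulCommClass H k U]
  {c : G → U} (hc : ∀ g h : G, c (g * h) = c g + π g • c h)

variable (k) in
/-- The extension of the action of `g` to `U[T]` with `T ↦ T + c g`. -/
noncomputable def affineMap (c : G → U) (g : G) : U[X] →ₐ[k] U[X] :=
  ((aeval (X + C (c g)) : U[X] →ₐ[U] U[X]).restrictScalars k).comp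
    (mapAlgHom (MulSemiringAction.toAlgHom k U (π g)))

theorem affineMap_apply (g : G) (f : U[X]) :
    affineMap k π c g f = (f.map (MulSemiringAction.toRingHom H U (π g))).comp (X + C (c g)) :=
  rfl

theorem affineMap_C (g : G) (a : U) : affineMap k π c g (C a) = C (π g • a) := by
  simp [affineMap_apply]

theorem affineMap_X (g : G) : affineMap k π c g X = X + C (c g) := by
  simp [affineMap_apply]

variable (k) in
/-- The action of `G` on `U[T]` given by the action on `U` and `g T = T + c g`. -/
noncomputable def affineHom : G →* (U[X] →ₐ[k] U[X]) where
  toFun := affineMap k π c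
  map_one' := by
    have h1 : c 1 = 0 := by simpa using hc 1 1
    refine Polynomial.algHom_ext' (AlgHom.ext fun a => ?_) ?_
    · simp [affineMap_C]
    · simp [affineMap_X, h1]
  map_mul' g h := by
    refine Polynomial.algHom_ext' (AlgHom.ext fun a => ?_) ?_
    · simp [affineMap_C, mul_smul]
    · simp only [AlgHom.mul_apply, affineMap_X, map_add, affineMap_C, hc]
      ring

theorem affineHom_apply (g : G) (f : U[X]) : affineHom k π hc g f =
    (f.map (MulSemiringAction.toRingHom H U (π g))).comp (X + C (c g)) := rfl

theorem affineHom_C (g : G) (a : U) : affineHom k π hc g (C a) = C (π g • a) := affineMap_C π g a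

theorem affineHom_X (g : G) : affineHom k π hc g X = X + C (c g) := affineMap_X π g

theorem natDegree_affineHom_le (g : G) (f : U[X]) :
    (affineHom k π hc g f).natDegree ≤ f.natDegree := by
  nontriviality U
  rw [affineHom_apply]
  refine natDegree_comp_le.trans ?_
  rw [natDegree_X_add_C, mul_one]
  exact natDegree_map_le

variable [IsDomain U]

/-- If `Y` is a monic invariant such that all invariants of smaller degree are constant, then `Y`
generates the invariants of `U[T]` over those of `U`. -/
theorem exists_comp_eq_of_invariant (hπ : Function.Surjective π) {Y : U[X]} (hY : Y.Monic)
    (hdeg : 0 < Y.natDegree) (hinv : ∀ g, affineHom k π hc g Y = Y)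
    (hconst : ∀ r : U[X], r.natDegree < Y.natDegree → (∀ g, affineHom k π hc g r = r) →
      ∃ a, r = C a) (f : U[X]) (hf : ∀ g, affineHom k π hc g f = f) :
    ∃ q : (FixedPoints.subalgebra k U H)[X],
      (q.map (FixedPoints.subalgebra k U H).val.toRingHom).comp Y = f := by
  have hC : ∀ a : U, (∀ g, affineHom k π hc g (C a) = C a) →
      a ∈ FixedPoints.subalgebra k U H := by
    intro a ha h
    obtain ⟨g, rfl⟩ := hπ h
    have := ha g
    rw [affineHom_C] at this
    exact C_injective this
  have hY1 : Y ≠ 1 := fun h => by simp [h] at hdeg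
  induction hn : f.natDegree using Nat.strong_induction_on generalizing f with
  | _ n ih =>
    have hdecomp : ∀ g, affineHom k π hc g (f /ₘ Y) = f /ₘ Y ∧
        affineHom k π hc g (f %ₘ Y) = f %ₘ Y := by
      intro g
      -- The action fixes Y and does not raise degrees, so uniqueness of division with remainder
      -- makes quotient and remainder invariant.
      have h := div_modByMonic_unique (f := f) (affineHom k π hc g (f /ₘ Y))
        (affineHom k π hc g (f %ₘ Y)) hY ⟨by
          have := congrArg (affineHom k π hc g) (modByMonic_add_div f Y)
          rwa [map_add, map_mul, hinv, hf] at this,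
          degree_lt_degree ((natDegree_affineHom_le π hc g _).trans_lt
            (natDegree_modByMonic_lt f hY hY1))⟩
      exact ⟨h.1.symm, h.2.symm⟩
    obtain ⟨a, ha⟩ := hconst _ (natDegree_modByMonic_lt f hY hY1) fun g => (hdecomp g).2
    have ha' : a ∈ FixedPoints.subalgebra k U H := hC a fun g => ha ▸ (hdecomp g).2
    by_cases hlt : f.natDegree < Y.natDegree
    · have hfa : f = C a := by
        rw [← ha, (modByMonic_eq_self_iff hY).2 (degree_lt_degree hlt)]
      refine ⟨C ⟨a, ha'⟩, ?_⟩
      rw [map_C, C_comp, hfa]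
      rfl
    · obtain ⟨q, hq⟩ := ih (f /ₘ Y).natDegree
        (by rw [natDegree_divByMonic f hY]; omega) _ (fun g => (hdecomp g).1) rfl
      refine ⟨C ⟨a, ha'⟩ + X * q, ?_⟩
      rw [Polynomial.map_add, Polynomial.map_mul, map_C, map_X, add_comp, mul_comp, C_comp, X_comp,
        hq]
      refine Eq.trans ?_ (modByMonic_add_div f Y)
      rw [ha]
      rfl

/-- Substituting Y for the variable is injective because Y is not constant, and it reaches every
invariant by repeated division by Y. -/
theorem nonempty_fixedPoints_affine (hπ : Function.Surjective π) {Y : U[X]} (hY : Y.Monic)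
    (hdeg : 0 < Y.natDegree) (hinv : ∀ g, affineHom k π hc g Y = Y)
    (hconst : ∀ r : U[X], r.natDegree < Y.natDegree → (∀ g, affineHom k π hc g r = r) →
      ∃ a, r = C a) :
    Nonempty ((FixedPoints.subalgebra k U H)[X] ≃ₐ[k]
      FixedPoints.subalgebra k (WithAction (affineHom k π hc)) G) := by
  let ι : FixedPoints.subalgebra k U H →ₐ[k] U := (FixedPoints.subalgebra k U H).val
  let Ψ : (FixedPoints.subalgebra k U H)[X] →ₐ[k] WithAction (affineHom k π hc) :=
    (WithAction.equiv (affineHom k π hc) : U[X] →ₐ[k] _).comp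
      (((aeval Y : U[X] →ₐ[U] U[X]).restrictScalars k).comp (mapAlgHom ι))
  have hΨ : ∀ q, Ψ q = WithAction.equiv (affineHom k π hc) ((q.map ι.toRingHom).comp Y) :=
    fun q => rfl
  have hmem : ∀ q, Ψ q ∈ FixedPoints.subalgebra k (WithAction (affineHom k π hc)) G := by
    intro q g
    induction q using Polynomial.induction_on' with
    | add p q hp hq => rw [map_add, smul_add, hp, hq]
    | monomial n a =>
      rw [hΨ, WithAction.smul_equiv, map_monomial, monomial_comp, map_mul, map_pow, hinv,
        affineHom_C]
      congr 3
      exact a.2 (π g)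
  refine ⟨AlgEquiv.ofBijective (Ψ.codRestrict _ hmem) ⟨?_, ?_⟩⟩
  · refine (AlgHom.injective_codRestrict _ _ _).2 ((injective_iff_map_eq_zero Ψ).2 fun q hq => ?_)
    rw [hΨ, map_eq_zero_iff _ (AlgEquiv.injective _), comp_eq_zero_iff] at hq
    rcases hq with hq | ⟨-, hq⟩
    · exact (Polynomial.map_eq_zero_iff Subtype.val_injective).1 hq
    · rw [hq, natDegree_C] at hdeg
      exact absurd hdeg (lt_irrefl 0)
  · rintro ⟨m, hm⟩
    obtain ⟨f, rfl⟩ := (WithAction.equiv (affineHom k π hc)).surjective m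
    obtain ⟨q, hq⟩ := exists_comp_eq_of_invariant π hc hπ hY hdeg hinv hconst f
      fun g => (WithAction.equiv (affineHom k π hc)).injective (hm g)
    exact ⟨q, Subtype.ext ((hΨ q).trans (congrArg _ hq))⟩

end AffineExtension

end ModularInvariants

namespace ModularInvariants

open Polynomial

/-! ### The inductive step along a central subgroup of order p. -/

section AffineStep

variable {k : Type*} [Field k] {p : ℕ} [CharP k p]
  {G : Type*} [Group G] {z : G} [(Subgroup.zpowers z).Normal]
  {U : Type*} [CommRing U] [Algebra k U] [MulSemiringAction (G ⧸ Subgroup.zpowers z) U]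
  [SMulCommClass (G ⧸ Subgroup.zpowers z) k U] {c : G → U}
  (hc : ∀ g h : G, c (g * h) = c g + QuotientGroup.mk' (Subgroup.zpowers z) g • c h)

theorem mk'_generator : QuotientGroup.mk' (Subgroup.zpowers z) z = 1 :=
  (QuotientGroup.eq_one_iff z).2 (Subgroup.mem_zpowers z)

theorem affineHom_generator_pow_X (hcz : c z = 1) (m : ℕ) :
    affineHom k (QuotientGroup.mk' (Subgroup.zpowers z)) hc (z ^ m) X = X + (m : U[X]) := by
  induction m with
  | zero => simp
  | succ m ih =>
    rw [pow_succ', map_mul, AlgHom.mul_apply, ih, map_add, affineHom_X, hcz, map_natCast, map_one]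
    push_cast
    ring

theorem affineHom_generator_pow_C (m : ℕ) (a : U) :
    affineHom k (QuotientGroup.mk' (Subgroup.zpowers z)) hc (z ^ m) (C a) = C a := by
  rw [affineHom_C, map_pow, mk'_generator, one_pow, one_smul]

/-- Invariance under z reads r(T + 1) = r(T). Hence r - r(0) vanishes at the p distinct points 0, …,
p - 1, too many for its degree. -/
theorem eq_C_of_invariant [IsDomain U] (hcz : c z = 1) (r : U[X]) (hr : r.natDegree < p)
    (hinv : ∀ g, affineHom k (QuotientGroup.mk' (Subgroup.zpowers z)) hc g r = r) :
    ∃ a, r = C a := by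
  have : CharP U p := charP_of_injective_algebraMap (algebraMap k U).injective p
  refine ⟨r.eval 0, sub_eq_zero.1 ?_⟩
  have hstep : ∀ a : U, r.eval (a + 1) = r.eval a := by
    intro a
    have h := hinv z
    have h1 : MulSemiringAction.toRingHom (G ⧸ Subgroup.zpowers z) U
        (QuotientGroup.mk' (Subgroup.zpowers z) z) = RingHom.id U := by
      rw [mk'_generator]
      ext a
      simp
    rw [affineHom_apply, h1, Polynomial.map_id, hcz] at h
    conv_rhs => rw [← h]
    simp
  have hnat : ∀ m : ℕ, r.eval (m : U) = r.eval 0 := by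
    intro m
    induction m with
    | zero => simp
    | succ m ih => rw [Nat.cast_succ, hstep, ih]
  refine eq_zero_of_natDegree_lt_card_of_eval_eq_zero _ (f := fun i : Fin p => ((i : ℕ) : U))
    (fun i j hij => ?_) (fun i => ?_) ?_
  · exact Fin.ext (CharP.natCast_injOn_Iio U p i.2 j.2 hij)
  · simp [hnat]
  · rw [Fintype.card_fin]
    rwa [natDegree_sub_C]

/-- T is placed last, so c(g), an element of U, is a polynomial in the preceding variables. -/
theorem isTriangularPolynomial_affine {n : ℕ}
    (hU : IsTriangularPolynomial k (G ⧸ Subgroup.zpowers z) U n) :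
    IsTriangularPolynomial k G
      (WithAction (affineHom k (QuotientGroup.mk' (Subgroup.zpowers z)) hc)) (n + 1) := by
  obtain ⟨e, he⟩ := hU
  let σ := affineHom k (QuotientGroup.mk' (Subgroup.zpowers z)) hc
  let e' : MvPolynomial (Fin (n + 1)) k ≃ₐ[k] WithAction σ :=
    ((MvPolynomial.renameEquiv k (finSuccEquivLast (n := n))).trans
      (MvPolynomial.optionEquivLeft k (Fin n))).trans
        ((Polynomial.mapAlgEquiv e).trans (WithAction.equiv σ))
  have hlast : e' (MvPolynomial.X (Fin.last n)) = WithAction.equiv σ X := by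
    simp [e']
  have hcast : ∀ i : Fin n, e' (MvPolynomial.X i.castSucc) =
      WithAction.equiv σ (C (e (MvPolynomial.X i))) := by
    intro i
    simp [e']
  let ι : U →ₐ[k] WithAction σ :=
    (WithAction.equiv σ : U[X] →ₐ[k] WithAction σ).comp (CAlgHom : U →ₐ[k] U[X])
  have hι : ∀ a, ι a = WithAction.equiv σ (C a) := fun _ => rfl
  refine ⟨e', fun g i => ?_⟩
  induction i using Fin.lastCases with
  | last =>
    rw [hlast, WithAction.smul_equiv, affineHom_X, map_add, add_sub_cancel_left, ← hι]
    have h1 : (⊤ : Subalgebra k U).map ι ≤ Algebra.adjoin k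
        ((fun j : Fin (n + 1) => e' (MvPolynomial.X j)) '' {j | j < Fin.last n}) := by
      have h2 : (⊤ : Subalgebra k U) =
          Algebra.adjoin k (Set.range fun i : Fin n => e (MvPolynomial.X i)) := by
        have h3 : (e : MvPolynomial (Fin n) k →ₐ[k] U).range = ⊤ :=
          (AlgHom.range_eq_top _).2 e.surjective
        rw [← h3, ← Algebra.map_top, ← MvPolynomial.adjoin_range_X, AlgHom.map_adjoin,
          ← Set.range_comp]
        rfl
      rw [h2, AlgHom.map_adjoin]
      refine Algebra.adjoin_mono ?_
      rintro _ ⟨_, ⟨i, rfl⟩, rfl⟩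
      exact ⟨i.castSucc, Fin.castSucc_lt_last i, (hcast i).trans (hι _).symm⟩
    exact h1 ⟨c g, trivial, rfl⟩
  | cast i =>
    rw [hcast, WithAction.smul_equiv, affineHom_C, ← hι, ← hι, ← map_sub]
    have h1 : (Algebra.adjoin k ((fun j : Fin n => e (MvPolynomial.X j)) '' {j | j < i})).map ι ≤
        Algebra.adjoin k
          ((fun j : Fin (n + 1) => e' (MvPolynomial.X j)) '' {j | j < i.castSucc}) := by
      rw [AlgHom.map_adjoin]
      refine Algebra.adjoin_mono ?_
      rintro _ ⟨_, ⟨j, hj, rfl⟩, rfl⟩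
      exact ⟨j.castSucc, Fin.castSucc_lt_castSucc_iff.2 hj, (hcast j).trans (hι _).symm⟩
    exact h1 ⟨_, he _ i, rfl⟩

variable [Fintype (G ⧸ Subgroup.zpowers z)] {u : U}

theorem exists_affine_trace_eq_one [Fact p.Prime] [Fintype G] [Nontrivial U] (hz : orderOf z = p)
    (hcz : c z = 1) (hu : trace (G ⧸ Subgroup.zpowers z) u = 1) :
    ∃ f : WithAction (affineHom k (QuotientGroup.mk' (Subgroup.zpowers z)) hc),
      trace G f = 1 := by
  have : CharP U[X] p := charP_of_injective_algebraMap (algebraMap k U[X]).injective p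
  let σ := affineHom k (QuotientGroup.mk' (Subgroup.zpowers z)) hc
  -- Over ⟨z⟩ the translates of uT^(p-1) sum to uΣ(T + i)^(p-1) = -u. Summing over the cosets gives
  -- -tr(u) = -1, whence the sign.
  refine ⟨WithAction.equiv σ (-(C u * X ^ (p - 1))), ?_⟩
  have h1 : ∑ g : G, σ g (C u * X ^ (p - 1)) = -1 := by
    rw [sum_eq_sum_quotient hz]
    have h2 : ∀ q : G ⧸ Subgroup.zpowers z,
        ∑ i : ZMod p, σ (q.out * z ^ i.val) (C u * X ^ (p - 1)) = -C (q • u) := by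
      intro q
      have h3 : ∀ i : ZMod p, σ (q.out * z ^ i.val) (C u * X ^ (p - 1)) =
          σ q.out (C u * (X + (ZMod.cast i : U[X])) ^ (p - 1)) := by
        intro i
        rw [map_mul σ, AlgHom.mul_apply, map_mul (σ (z ^ i.val)), map_pow (σ (z ^ i.val)),
          affineHom_generator_pow_X hc hcz, affineHom_generator_pow_C, ZMod.natCast_val]
      simp only [h3]
      rw [← map_sum, ← Finset.mul_sum, sum_add_pow_card_sub_one, mul_neg_one, map_neg,
        affineHom_C]
      congr 3
      exact QuotientGroup.out_eq' q
    simp only [h2]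
    rw [Finset.sum_neg_distrib, ← map_sum]
    change -C (trace _ u) = _
    rw [hu, map_one]
  simp only [trace, WithAction.smul_equiv]
  rw [← map_sum]
  simp only [map_neg, Finset.sum_neg_distrib]
  change WithAction.equiv σ (-∑ g : G, σ g _) = 1
  rw [h1, neg_neg, map_one]

/-- T^p - T is fixed by z, and any g moves it only by the constant c(g)^p - c(g). The sum of the
translates of u(T^p - T) over the cosets is therefore invariant, and tr(u) = 1 makes it T^p - T plus
a constant. -/
theorem exists_monic_invariant [Fact p.Prime] [Nontrivial U] (hcz : c z = 1)
    (hu : trace (G ⧸ Subgroup.zpowers z) u = 1) :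
    ∃ Y : U[X], Y.Monic ∧ Y.natDegree = p ∧
      ∀ g, affineHom k (QuotientGroup.mk' (Subgroup.zpowers z)) hc g Y = Y := by
  have : CharP U[X] p := charP_of_injective_algebraMap (algebraMap k U[X]).injective p
  let σ := affineHom k (QuotientGroup.mk' (Subgroup.zpowers z)) hc
  have hp : 1 < p := (Fact.out : p.Prime).one_lt
  have hσ : ∀ g, σ g (X ^ p - X) = X ^ p - X + C (c g ^ p - c g) := by
    intro g
    rw [map_sub, map_pow, affineHom_X, add_pow_char, map_sub, map_pow]
    ring
  have hw : ∀ g, σ (g * z) (C u * (X ^ p - X)) = σ g (C u * (X ^ p - X)) := by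
    intro g
    rw [map_mul σ, AlgHom.mul_apply, map_mul (σ z), hσ z, hcz, one_pow, sub_self, map_zero,
      add_zero, ← pow_one z, affineHom_generator_pow_C]
  let a : U := ∑ q : G ⧸ Subgroup.zpowers z, q • u * (c q.out ^ p - c q.out)
  have hY : ∑ q : G ⧸ Subgroup.zpowers z, σ q.out (C u * (X ^ p - X)) = X ^ p - (X - C a) := by
    have : ∀ q : G ⧸ Subgroup.zpowers z, σ q.out (C u * (X ^ p - X)) =
        C (q • u) * (X ^ p - X) + C (q • u * (c q.out ^ p - c q.out)) := by
      intro q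
      rw [map_mul, hσ, affineHom_C, mul_add, map_mul C]
      congr <;> exact QuotientGroup.out_eq' q
    simp only [this]
    rw [Finset.sum_add_distrib, ← Finset.sum_mul, ← map_sum, ← map_sum]
    change C (trace _ u) * _ + C a = _
    rw [hu, map_one]
    ring
  refine ⟨X ^ p - (X - C a), ?_, ?_, fun g => ?_⟩
  · obtain ⟨m, rfl⟩ : ∃ m, p = m + 1 := ⟨p - 1, by omega⟩
    refine monic_X_pow_sub ?_
    rw [degree_X_sub_C]
    exact_mod_cast hp
  · rw [natDegree_sub_eq_left_of_natDegree_lt, natDegree_X_pow]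
    rwa [natDegree_X_sub_C, natDegree_X_pow]
  · rw [← hY, map_sum, ← sum_out_mul_of_mul_right_invariant
      (F := fun h => σ h (C u * (X ^ p - X))) hw g]
    exact Finset.sum_congr rfl fun q _ => by rw [map_mul σ]; rfl

end AffineStep

theorem isPolynomialRing_polynomial {k : Type*} [Field k] {A : Type*} [CommRing A] [Algebra k A]
    {n : ℕ} (hA : IsPolynomialRing k A n) : IsPolynomialRing k A[X] (n + 1) := by
  obtain ⟨e⟩ := hA
  exact ⟨((MvPolynomial.renameEquiv k (finSuccEquivLast (n := n))).trans
    ((MvPolynomial.optionEquivLeft k (Fin n)).trans (Polynomial.mapAlgEquiv e.symm))).symm⟩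

theorem exists_central_orderOf_eq {p : ℕ} [Fact p.Prime] {G : Type*} [Group G] [Finite G] {n : ℕ}
    (hG : Nat.card G = p ^ (n + 1)) : ∃ z ∈ Subgroup.center G, orderOf z = p := by
  have hp : p.Prime := Fact.out
  have : Nontrivial G := Finite.one_lt_card_iff_nontrivial.1
    (hG ▸ Nat.one_lt_pow n.succ_ne_zero hp.one_lt)
  have hP : IsPGroup p G := IsPGroup.of_card hG
  have := hP.center_nontrivial
  obtain ⟨m, hm, hcard⟩ := (hP.to_subgroup (Subgroup.center G)).nontrivial_iff_card.1 inferInstance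
  obtain ⟨z, hz⟩ := exists_prime_orderOf_dvd_card' (G := Subgroup.center G) p
    (hcard ▸ dvd_pow_self p hm.ne')
  exact ⟨z, z.2, by rw [Subgroup.orderOf_coe, hz]⟩

/-- Every finite `p`-group acts triangularly and with surjective trace on a polynomial ring with
polynomial invariants in `log_p |G|` variables. -/
theorem exists_triangular_trace_eq_one (k : Type u) [Field k] (p : ℕ) [Fact p.Prime] [CharP k p]
    (n : ℕ) : ∀ (G : Type w) [Group G] [Fintype G], Nat.card G = p ^ n →
      ∃ (U : Type u) (_ : CommRing U) (_ : Algebra k U) (_ : MulSemiringAction G U)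
        (_ : SMulCommClass G k U), IsTriangularPolynomial k G U n ∧
          (∃ u : U, trace G u = 1) ∧ IsPolynomialRing k (FixedPoints.subalgebra k U G) n := by
  induction n with
  | zero =>
    intro G _ _ hG
    have : Subsingleton G := (Nat.card_eq_one_iff_unique.1 (by simpa using hG)).1
    let ρ : G →* (MvPolynomial (Fin 0) k →ₐ[k] MvPolynomial (Fin 0) k) := 1
    refine ⟨WithAction ρ, inferInstance, inferInstance, inferInstance, inferInstance,
      ⟨WithAction.equiv ρ, fun g i => i.elim0⟩, ⟨1, ?_⟩, ⟨?_⟩⟩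
    · rw [trace, Fintype.sum_subsingleton _ (1 : G), one_smul]
    · have : FixedPoints.subalgebra k (WithAction ρ) G = ⊤ :=
        top_le_iff.1 fun a _ g => by rw [Subsingleton.elim g 1, one_smul]
      exact (Subalgebra.equivOfEq _ _ this).trans
        (Subalgebra.topEquiv.trans (WithAction.equiv ρ).symm)
  | succ n ih =>
    intro G _ _ hG
    have hp : p.Prime := Fact.out
    obtain ⟨z, hcen, hz⟩ := exists_central_orderOf_eq hG
    have : (Subgroup.zpowers z).Normal :=
      ⟨fun x hx g => by
        have h : x ∈ Subgroup.center G := (Subgroup.zpowers_le.2 hcen) hx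
        rwa [Subgroup.mem_center_iff.1 h g, mul_inv_cancel_right]⟩
    have : Fintype (G ⧸ Subgroup.zpowers z) := Fintype.ofFinite _
    have hcard : Nat.card (G ⧸ Subgroup.zpowers z) = p ^ n := by
      have := Subgroup.card_eq_card_quotient_mul_card_subgroup (Subgroup.zpowers z)
      rw [hG, Nat.card_zpowers, hz, pow_succ] at this
      exact (Nat.eq_of_mul_eq_mul_right hp.pos this).symm
    obtain ⟨U, _, _, _, _, hU, ⟨u, hu⟩, hinv⟩ := ih (G ⧸ Subgroup.zpowers z) hcard
    have : IsDomain U := by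
      obtain ⟨e, -⟩ := hU
      exact e.symm.toMulEquiv.isDomain _
    obtain ⟨c, hc, hcz⟩ := exists_cocycle (k := k) hz hcen hu
    have hc : ∀ g h : G, c (g * h) = c g + QuotientGroup.mk' (Subgroup.zpowers z) g • c h := hc
    obtain ⟨Y, hY, hYdeg, hYinv⟩ := exists_monic_invariant (k := k) (p := p) hc hcz hu
    refine ⟨WithAction (affineHom k _ hc), inferInstance, inferInstance, inferInstance,
      inferInstance, isTriangularPolynomial_affine hc hU,
      exists_affine_trace_eq_one hc hz hcz hu, ?_⟩
    obtain ⟨E⟩ := nonempty_fixedPoints_affine (k := k) _ hc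
      (QuotientGroup.mk'_surjective (Subgroup.zpowers z)) hY (hYdeg ▸ hp.pos) hYinv
      fun r hr hrinv => eq_C_of_invariant hc hcz r (hYdeg ▸ hr) hrinv
    obtain ⟨E'⟩ := isPolynomialRing_polynomial hinv
    exact ⟨E.symm.trans E'⟩

end ModularInvariants

namespace ModularInvariants

/-! ### Linear representations of p-groups are triangular. -/

section FixedVectors

variable {k : Type*} [Field k] {p : ℕ} [Fact p.Prime] [CharP k p] {G : Type*} [Group G] [Finite G]
  {V : Type*} [AddCommGroup V] [Module k V]

/-- The F_p-span of one orbit is finite even if k is not, and its cardinality is divisible by p.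
Counting orbits modulo p gives a fixed point besides 0. -/
theorem exists_fixed_vector (hG : IsPGroup p G) (ρ : Representation k G V) [Nontrivial V] :
    ∃ v : V, v ≠ 0 ∧ ∀ g, ρ g v = v := by
  obtain ⟨v, hv⟩ := exists_ne (0 : V)
  have hpV : ∀ x : V, p • x = 0 := fun x => by
    rw [← Nat.cast_smul_eq_nsmul k, CharP.cast_eq_zero, zero_smul]
  obtain ⟨_⟩ : Nonempty (Module (ZMod p) V) := ⟨AddCommGroup.zmodModule hpV⟩
  let W : Submodule (ZMod p) V := Submodule.span (ZMod p) (Set.range fun g : G => ρ g v)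
  have : Module.Finite (ZMod p) ↥W :=
    Module.Finite.iff_fg.2 (Submodule.fg_span (Set.finite_range _))
  have : Finite ↥W := Module.finite_of_finite (ZMod p)
  have hvW : v ∈ W := Submodule.subset_span ⟨1, by simp⟩
  have hW : ∀ g : G, ∀ x ∈ W, ρ g x ∈ W := by
    intro g x hx
    induction hx using Submodule.span_induction with
    | mem x hx =>
      obtain ⟨h, rfl⟩ := hx
      exact Submodule.subset_span ⟨g * h, by simp⟩
    | zero => simp
    | add x y _ _ hx hy => rw [map_add]; exact add_mem hx hy
    | smul a x _ hx =>
      have : ρ g (a • x) = a • ρ g x := ZMod.map_smul (ρ g).toAddMonoidHom a x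
      rw [this]
      exact W.smul_mem a hx
  let _ : MulAction G W :=
    { smul := fun g x => ⟨ρ g x, hW g x x.2⟩
      one_smul := fun x => Subtype.ext (by change ρ 1 (x : V) = x; simp)
      mul_smul := fun g h x => Subtype.ext (by
        change ρ (g * h) (x : V) = ρ g (ρ h x); simp) }
  have hsmul : ∀ (g : G) (x : W), ((g • x : W) : V) = ρ g x := fun _ _ => rfl
  have hdvd : p ∣ Nat.card W := by
    have h : addOrderOf (⟨v, hvW⟩ : W) = p :=
      addOrderOf_eq_prime (Subtype.ext (hpV v)) fun h => hv (congrArg Subtype.val h)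
    have h' := addOrderOf_dvd_natCard (⟨v, hvW⟩ : W)
    rwa [h] at h'
  obtain ⟨x, hx, hx0⟩ := hG.exists_fixed_point_of_prime_dvd_card_of_fixed_point W hdvd
    (a := 0) fun g => Subtype.ext (by rw [hsmul]; simp)
  exact ⟨x, fun h => hx0 (Subtype.ext h).symm, fun g => congrArg Subtype.val (hx g)⟩

/-- The next vector lifts a nonzero fixed vector of the quotient by the span of the previous ones.
-/
theorem exists_triangular_family [FiniteDimensional k V] (hG : IsPGroup p G)
    (ρ : Representation k G V) (m : ℕ) (hm : m ≤ Module.finrank k V) :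
    ∃ f : Fin m → V, LinearIndependent k f ∧
      ∀ g i, ρ g (f i) - f i ∈ Submodule.span k (f '' {j | j < i}) := by
  induction m with
  | zero => exact ⟨Fin.elim0, linearIndependent_empty_type, fun _ i => i.elim0⟩
  | succ m ih =>
    obtain ⟨f, hli, hf⟩ := ih (by omega)
    let W : Submodule k V := Submodule.span k (Set.range f)
    have hW : ∀ g, W ≤ W.comap (ρ g) := by
      intro g
      rw [Submodule.span_le]
      rintro _ ⟨i, rfl⟩
      have h1 : ρ g (f i) - f i ∈ W := Submodule.span_mono (Set.image_subset_range _ _) (hf g i)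
      have h2 : f i ∈ W := Submodule.subset_span ⟨i, rfl⟩
      simpa using add_mem h1 h2
    have : Nontrivial (V ⧸ W) := by
      refine Submodule.Quotient.nontrivial_iff.2 fun h => ?_
      have := finrank_span_eq_card hli
      change Module.finrank k W = _ at this
      rw [h, finrank_top, Fintype.card_fin] at this
      omega
    obtain ⟨y, hy, hyG⟩ := exists_fixed_vector hG (ρ.quotient W hW)
    obtain ⟨y, rfl⟩ := W.mkQ_surjective y
    have hyW : y ∉ W := fun h => hy ((Submodule.Quotient.mk_eq_zero W).2 h)
    refine ⟨Fin.snoc f y, linearIndependent_finSnoc.2 ⟨hli, hyW⟩, fun g i => ?_⟩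
    induction i using Fin.lastCases with
    | last =>
      have h1 : ρ g y - y ∈ W := by
        rw [← Submodule.Quotient.mk_eq_zero, Submodule.Quotient.mk_sub, sub_eq_zero]
        exact hyG g
      rw [Fin.snoc_last]
      refine Submodule.span_mono ?_ h1
      rintro _ ⟨i, rfl⟩
      exact ⟨i.castSucc, Fin.castSucc_lt_last i, by rw [Fin.snoc_castSucc]⟩
    | cast i =>
      rw [Fin.snoc_castSucc]
      refine Submodule.span_mono ?_ (hf g i)
      rintro _ ⟨j, hj, rfl⟩
      exact ⟨j.castSucc, Fin.castSucc_lt_castSucc_iff.2 hj, by rw [Fin.snoc_castSucc]⟩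

theorem isTriangularPolynomial_symDual {k : Type u} [Field k] {p : ℕ} [Fact p.Prime] [CharP k p]
    {G : Type w} [Group G] [Finite G] (hG : IsPGroup p G) {V : Type x} [AddCommGroup V]
    [Module k V] [FiniteDimensional k V] (ρ : Representation k G V) :
    IsTriangularPolynomial k G (SymDual ρ) (Module.finrank k V) := by
  obtain ⟨f, hli, hf⟩ := exists_triangular_family hG ρ.dual (Module.finrank k V)
    Subspace.dual_finrank_eq.ge
  let b : Module.Basis (Fin (Module.finrank k V)) k (Module.Dual k V) :=
    basisOfLinearIndependentOfCardEqFinrank' f hli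
      (by rw [Fintype.card_fin, Subspace.dual_finrank_eq])
  have hb : ∀ i, b i = f i := fun i => by simp [b]
  let e : MvPolynomial (Fin (Module.finrank k V)) k ≃ₐ[k] SymDual ρ :=
    (SymmetricAlgebra.equivMvPolynomial b).symm
  have he : ∀ i, e (MvPolynomial.X i) = SymDual.ι ρ (f i) := fun i => by
    rw [← hb]
    exact SymmetricAlgebra.equivMvPolynomial_symm_X b i
  refine ⟨e, fun g i => ?_⟩
  have h1 : g • e (MvPolynomial.X i) - e (MvPolynomial.X i) =
      SymDual.ι ρ (ρ.dual g (f i) - f i) := by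
    rw [he, map_sub, ← SymDual.act_ι]
    rfl
  rw [h1]
  have h2 : Submodule.span k (f '' {j | j < i}) ≤ (Subalgebra.toSubmodule (Algebra.adjoin k
      ((fun j => e (MvPolynomial.X j)) '' {j | j < i}))).comap (SymDual.ι ρ) := by
    rw [Submodule.span_le]
    rintro _ ⟨j, hj, rfl⟩
    exact Algebra.subset_adjoin ⟨j, hj, he j⟩
  exact h2 (hf g i)

end FixedVectors

end ModularInvariants

namespace ModularInvariants

/-! ### Stability properties of polynomial rings. -/

section PolynomialRings

variable {k : Type*} [Field k] {A : Type*} [CommRing A] [Algebra k A]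

variable (k A) in
/-- Extension of scalars of a polynomial ring, as an isomorphism of `k`-algebras. -/
noncomputable def tensorMvPolynomialEquiv (σ : Type*) :
    A ⊗[k] MvPolynomial σ k ≃ₐ[k] MvPolynomial σ A :=
  (MvPolynomial.algebraTensorAlgEquiv k A).restrictScalars k

theorem IsPolynomialRing.of_algEquiv {B : Type*} [CommRing B] [Algebra k B] {n : ℕ}
    (hA : IsPolynomialRing k A n) (e : A ≃ₐ[k] B) : IsPolynomialRing k B n :=
  hA.map e.symm.trans

theorem IsPolynomialRing.mvPolynomial {n : ℕ} (hA : IsPolynomialRing k A n) (d : ℕ) :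
    IsPolynomialRing k (MvPolynomial (Fin d) A) (d + n) := by
  obtain ⟨e⟩ := hA
  exact ⟨(MvPolynomial.mapAlgEquiv (Fin d) e).trans
    ((MvPolynomial.sumAlgEquiv k (Fin d) (Fin n)).symm.trans
      (MvPolynomial.renameEquiv k finSumFinEquiv))⟩

theorem IsTriangularPolynomial.isPolynomialRing {G : Type*} [Group G] [MulSemiringAction G A]
    {d : ℕ} (hA : IsTriangularPolynomial k G A d) : IsPolynomialRing k A d :=
  let ⟨e, _⟩ := hA
  ⟨e.symm⟩

theorem IsPolynomialRing.finiteType {n : ℕ} (hA : IsPolynomialRing k A n) :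
    Algebra.FiniteType k A :=
  let ⟨e⟩ := hA
  Algebra.FiniteType.equiv inferInstance e.symm

theorem IsPolynomialRing.isDomain {n : ℕ} (hA : IsPolynomialRing k A n) : IsDomain A :=
  let ⟨e⟩ := hA
  e.toMulEquiv.isDomain _

theorem IsPolynomialRing.tensorProduct {B : Type*} [CommRing B] [Algebra k B] {m n : ℕ}
    (hA : IsPolynomialRing k A n) (hB : IsPolynomialRing k B m) :
    IsPolynomialRing k (A ⊗[k] B) (m + n) := by
  obtain ⟨e⟩ := hB
  exact (hA.mvPolynomial m).of_algEquiv
    ((Algebra.TensorProduct.congr AlgEquiv.refl e).trans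
      (tensorMvPolynomialEquiv k A (Fin m))).symm

end PolynomialRings

/-! ### Transfer of triangularity and of actions along isomorphisms. -/

section Transfer

theorem IsTriangularPolynomial.of_algEquiv {k : Type*} [Field k] {G : Type*} [Group G]
    {S : Type*} [CommRing S] [Algebra k S] [MulSemiringAction G S]
    {B : Type*} [CommRing B] [Algebra k B] [MulSemiringAction G B] {d : ℕ} (hS : IsTriangularPolynomial k G S d)
    (f : S ≃ₐ[k] B) (hf : IsEquivariant G (f : S →ₐ[k] B)) :
    IsTriangularPolynomial k G B d := by
  obtain ⟨e, he⟩ := hS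
  refine ⟨e.trans f, fun g i => ?_⟩
  have h1 : g • f (e (MvPolynomial.X i)) - f (e (MvPolynomial.X i)) =
      (f : S →ₐ[k] B) (g • e (MvPolynomial.X i) - e (MvPolynomial.X i)) := by
    rw [map_sub, hf]
    rfl
  have h2 := Subalgebra.mem_map.2 ⟨_, he g i, h1.symm⟩
  rwa [AlgHom.map_adjoin, Set.image_image] at h2

variable {k : Type*} [Field k] {G : Type*} [Group G]
  {S : Type*} [CommRing S] [Algebra k S] [MulSemiringAction G S] [SMulCommClass G k S]
  {R : Type*} [CommRing R] [Algebra k R] (e : R ≃ₐ[k] S)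

/-- The action of `G` on `R` obtained from an isomorphism with a `k`-`G`-algebra. -/
noncomputable def transferHom : G →* (R →ₐ[k] R) where
  toFun g := (e.symm : S →ₐ[k] R).comp ((MulSemiringAction.toAlgHom k S g).comp e)
  map_one' := AlgHom.ext fun a => by simp
  map_mul' g h := AlgHom.ext fun a => by simp [mul_smul]

/-- The isomorphism with the algebra carrying the transferred action. -/
noncomputable def transferEquiv : S ≃ₐ[k] WithAction (transferHom (G := G) e) :=
  e.symm.trans (WithAction.equiv _)

theorem isEquivariant_transferEquiv :
    IsEquivariant G (transferEquiv (G := G) e : S →ₐ[k] WithAction (transferHom (G := G) e)) := by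
  intro g a
  change WithAction.equiv _ (e.symm (g • a)) =
    WithAction.equiv _ (e.symm (g • e (e.symm a)))
  rw [AlgEquiv.apply_symm_apply]

end Transfer

/-! ### The algebra U ⊗ S and the two conclusions. -/

section Universal

variable {k : Type u} [Field k] {G : Type w} [Group G]
  {U : Type u} [CommRing U] [Algebra k U] [MulSemiringAction G U] [SMulCommClass G k U]

theorem map_inr_fixedPoints [Nontrivial U] {S : Type*} [CommRing S] [Algebra k S]
    [MulSemiringAction G S] [SMulCommClass G k S] :
    (FixedPoints.subalgebra k S G).map (Diagonal.inr k G U S) =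
      (Diagonal.inr k G U S).range ⊓ FixedPoints.subalgebra k (Diagonal k G U S) G := by
  ext x
  constructor
  · rintro ⟨s, hs, rfl⟩
    exact ⟨⟨s, rfl⟩, fun g =>
      (Diagonal.isEquivariant_inr g s).symm.trans (congrArg (Diagonal.inr k G U S) (hs g))⟩
  · rintro ⟨⟨s, rfl⟩, hs⟩
    exact ⟨s, fun g => Diagonal.inr_injective ((Diagonal.isEquivariant_inr g s).trans (hs g)), rfl⟩

variable [Fintype G] {n : ℕ} {y : U}

theorem isTsAlgebra_of_trace_eq_one {A : Type*} [CommRing A] [Algebra k A] [MulSemiringAction G A]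
    {m : ℕ} (hA : IsPolynomialRing k A m) {x : A} (hx : trace G x = 1) : IsTsAlgebra k G A :=
  ⟨hA.finiteType, isTraceSurjective_of_trace_eq_one (G := G) hx⟩

theorem trace_inl {S : Type*} [CommRing S] [Algebra k S] [MulSemiringAction G S]
    [SMulCommClass G k S] (hy : trace G y = 1) : trace G (Diagonal.inl k G U S y) = 1 := by
  rw [trace_map Diagonal.isEquivariant_inl, hy, map_one]

theorem isPolynomialRing_fixedPoints_diagonal (hU : IsTriangularPolynomial k G U n)
    (hy : trace G y = 1) (hUG : IsPolynomialRing k (FixedPoints.subalgebra k U G) n)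
    {S : Type*} [CommRing S] [Algebra k S] [MulSemiringAction G S] [SMulCommClass G k S] {d : ℕ}
    (hS : IsTriangularPolynomial k G S d) :
    IsPolynomialRing k (FixedPoints.subalgebra k (Diagonal k G U S) G) (d + n) := by
  have := hU.isPolynomialRing.finiteType
  have : IsNoetherianRing U := Algebra.FiniteType.isNoetherianRing k U
  obtain ⟨E⟩ := hS.nonempty_fixedPoints_diagonal (A := U) hy
  exact (hUG.mvPolynomial d).of_algEquiv E

/-- Both factors are triangular, so β lifts on each of them, and the product of the two lifts is
equivariant. The factor `U` supplies the element of trace 1. -/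
theorem isSProjective_diagonal (hU : IsTriangularPolynomial k G U n) (hy : trace G y = 1)
    {S : Type*} [CommRing S] [Algebra k S] [MulSemiringAction G S] [SMulCommClass G k S] {d : ℕ}
    (hS : IsTriangularPolynomial k G S d) : IsSProjective k G (Diagonal k G U S) := by
  refine ⟨isTsAlgebra_of_trace_eq_one
    ((hU.isPolynomialRing.tensorProduct hS.isPolynomialRing).of_algEquiv
      (WithAction.equiv (diagonalHom k G U S))) (trace_inl hy), ?_⟩
  intro A B _ _ _ _ _ _ _ _ hA _ α β hα hβ hsurj
  obtain ⟨a, ha⟩ := IsTraceSurjective.exists_trace_eq_one hA.2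
  refine Diagonal.exists_lift β (hU.exists_lift ha hα (fun g x => ?_) hsurj)
    (hS.exists_lift ha hα (fun g x => ?_) hsurj)
  · exact (congrArg β (Diagonal.isEquivariant_inl g x)).trans (hβ g _)
  · exact (congrArg β (Diagonal.isEquivariant_inr g x)).trans (hβ g _)

theorem exists_sProjective_extension (hU : IsTriangularPolynomial k G U n) (hy : trace G y = 1)
    (hUG : IsPolynomialRing k (FixedPoints.subalgebra k U G) n)
    {S : Type v} [CommRing S] [Algebra k S] [MulSemiringAction G S] [SMulCommClass G k S] {d : ℕ}
    (hS : IsTriangularPolynomial k G S d) :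
    ∃ (P : Type u) (_ : CommRing P) (_ : Algebra k P) (_ : MulSemiringAction G P)
      (_ : SMulCommClass G k P) (j : S →ₐ[k] P) (B C : Subalgebra k P) (b c : ℕ),
      IsPolynomialRing k P (d + n) ∧ IsSProjective k G P ∧
        Function.Injective j ∧ IsEquivariant G j ∧
        IsPolynomialRing k B b ∧ IsPolynomialRing k C c ∧
        (FixedPoints.subalgebra k S G).map j = B ⊓ C := by
  have hUdom := hU.isPolynomialRing.isDomain
  obtain ⟨e⟩ : Nonempty (MvPolynomial (Fin d) k ≃ₐ[k] S) := let ⟨e, _⟩ := hS; ⟨e⟩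
  -- P must live in the universe of k, so S is replaced by a copy carried by `MvPolynomial (Fin d)
  -- k`.
  let R := WithAction (transferHom (G := G) e)
  let f : S ≃ₐ[k] R := transferEquiv e
  have hf : IsEquivariant G (f : S →ₐ[k] R) := isEquivariant_transferEquiv e
  have hR : IsTriangularPolynomial k G R d := hS.of_algEquiv f hf
  have hinj : Function.Injective (Diagonal.inr k G U R) := Diagonal.inr_injective
  refine ⟨Diagonal k G U R, inferInstance, inferInstance, inferInstance, inferInstance,
    (Diagonal.inr k G U R).comp f, (Diagonal.inr k G U R).range,
    FixedPoints.subalgebra k (Diagonal k G U R) G, d, d + n,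
    (hU.isPolynomialRing.tensorProduct hR.isPolynomialRing).of_algEquiv
      (WithAction.equiv (diagonalHom k G U R)),
    isSProjective_diagonal hU hy hR, hinj.comp f.injective, fun g s => ?_,
    hR.isPolynomialRing.of_algEquiv (AlgEquiv.ofInjective _ hinj),
    isPolynomialRing_fixedPoints_diagonal hU hy hUG hR, ?_⟩
  · exact (congrArg (Diagonal.inr k G U R) (hf g s)).trans (Diagonal.isEquivariant_inr g (f s))
  · rw [← Subalgebra.map_map, IsEquivariant.map_fixedPoints f hf, map_inr_fixedPoints]

/-- The invariants of U ⊗ S are computed twice: over U^G, using the trace-1 element of `U`, and over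
S^G, using the one of `S`. -/
theorem isPolynomialRing_fixedPoints_tensorProduct (hU : IsTriangularPolynomial k G U n)
    (hy : trace G y = 1) (hUG : IsPolynomialRing k (FixedPoints.subalgebra k U G) n)
    {S : Type v} [CommRing S] [Algebra k S] [MulSemiringAction G S] [SMulCommClass G k S] {d : ℕ}
    (hS : IsTriangularPolynomial k G S d) (hTs : IsTsAlgebra k G S) :
    IsPolynomialRing k (FixedPoints.subalgebra k S G ⊗[k] MvPolynomial (Fin n) k) (n + d) := by
  obtain ⟨s, hs⟩ := IsTraceSurjective.exists_trace_eq_one hTs.2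
  have := hTs.1
  have : IsNoetherianRing S := Algebra.FiniteType.isNoetherianRing k S
  obtain ⟨E⟩ := hU.nonempty_fixedPoints_diagonal (A := S) hs
  rw [add_comm]
  refine (isPolynomialRing_fixedPoints_diagonal hU hy hUG hS).of_algEquiv
    ((fixedPointsEquiv (Diagonal.comm k G U S) Diagonal.isEquivariant_comm).trans (E.symm.trans ?_))
  exact (tensorMvPolynomialEquiv k (FixedPoints.subalgebra k S G) (Fin n)).symm

end Universal

end ModularInvariants

theorem theorem0p10 (k : Type u) [Field k] (p : ℕ) [Fact p.Prime] [CharP k p]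
    (G : Type w) [Group G] [Fintype G] (n : ℕ) (hG : Nat.card G = p ^ n) :
    (∀ (S : Type v) [CommRing S] [Algebra k S] [MulSemiringAction G S] [SMulCommClass G k S]
        (d : ℕ), ModularInvariants.IsTriangularPolynomial k G S d →
      (∃ (P : Type u) (_ : CommRing P) (_ : Algebra k P) (_ : MulSemiringAction G P)
          (_ : SMulCommClass G k P) (j : S →ₐ[k] P) (B C : Subalgebra k P) (b c : ℕ),
        ModularInvariants.IsPolynomialRing k P (d + n) ∧
        ModularInvariants.IsSProjective k G P ∧
        Function.Injective j ∧ ModularInvariants.IsEquivariant G j ∧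
        ModularInvariants.IsPolynomialRing k B b ∧
        ModularInvariants.IsPolynomialRing k C c ∧
        (FixedPoints.subalgebra k S G).map j = B ⊓ C) ∧
      (ModularInvariants.IsTsAlgebra k G S →
        ModularInvariants.IsPolynomialRing k
          (FixedPoints.subalgebra k S G ⊗[k] MvPolynomial (Fin n) k) (n + d))) ∧
    (∀ (V : Type x) [AddCommGroup V] [Module k V] [FiniteDimensional k V]
        (ρ : Representation k G V),
      ModularInvariants.IsTriangularPolynomial k G (ModularInvariants.SymDual ρ)
        (Module.finrank k V)) := by
  obtain ⟨U, _, _, _, _, hU, ⟨y, hy⟩, hUG⟩ :=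
    ModularInvariants.exists_triangular_trace_eq_one k p n G hG
  refine ⟨fun S _ _ _ _ d hS => ⟨?_, fun hTs => ?_⟩, fun V _ _ _ ρ => ?_⟩
  · exact ModularInvariants.exists_sProjective_extension hU hy hUG hS
  · exact ModularInvariants.isPolynomialRing_fixedPoints_tensorProduct hU hy hUG hS hTs
  · exact ModularInvariants.isTriangularPolynomial_symDual (IsPGroup.of_card hG) ρ
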